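/- Let $S(n,k)$ denote the Stirling numbers of the second kind and $\nu_2$ the $2$-adic valuation. For $l\in\mathbb Z$ let the higher order Bernoulli polynomials $B_n^{(l)}(x)\in\mathbb Q[x]$ be defined by $$\left(\frac{t}{e^t-1}\right)^{l}e^{tx}=\sum_{n\ge 0}B_n^{(l)}(x)\frac{t^n}{n!},$$ and for $1\le k\le n$ let $2^{M}$ and $2^{M'}$ be the highest powers of $2$ occurring in the denominators of the coefficients of $B_{n-k}^{(-k)}(x)$ and of $B_{n-k}^{(-k+1)}(x)$, respectively. The almost minimum zero (AMZ) estimate is $\nu_2(S(n,k))\ge \nu_2\left(\binom nk\right)-M$, and the shifted almost minimum zero (SAMZ) estimate is $\nu_2(S(n,k))\ge\nu_2\left(\binom{n-1}{k-1}\right)-M'$. One says that $S(n,k)$ is an AMZC (respectively a SAMZC) if the AMZ (respectively SAMZ) estimate holds with equality. Let $h,u,c$ be positive integers with $u<2^h$. Then: 1. The right-hand side of the SAMZ estimate for $S(c2^h+u,2^h)$ equals $h-1-\nu_2(u)$, and $\nu_2(S(c2^h+u,2^h))\ge h-1-\nu_2(u)$. 2. $S(c2^h+u,2^h)$ is a SAMZC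 if and only if $u$ is even and $u\le 2^{h-1}$, or $u=1$, or $u=1+2^{h-1}$. 3. In each of the cases listed in 2, $S(c2^h+u-1,2^h-1)$ is an AMZC and $$\nu_2(S(c2^h+u,2^h))=\nu_2(S(c2^h+u-1,2^h-1))=h-1-\nu_2(u).$$ -/

import Mathlib

/-- The power series `(e^t - 1) / t = ∑ tⁿ / (n + 1)!` over `ℚ`. -/
noncomputable def expSubOneDivX : PowerSeries ℚ :=
  PowerSeries.mk fun n => (1 : ℚ) / (Nat.factorial (n + 1) : ℚ)

theorem X_mul_expSubOneDivX :
    (PowerSeries.X : PowerSeries ℚ) * expSubOneDivX = PowerSeries.exp ℚ - 1 := by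
  ext n
  cases n with
  | zero => simp
  | succ n =>
    rw [PowerSeries.coeff_succ_X_mul]
    simp [expSubOneDivX, PowerSeries.coeff_exp, PowerSeries.coeff_one]

theorem isUnit_expSubOneDivX : IsUnit expSubOneDivX := by
  rw [PowerSeries.isUnit_iff_constantCoeff, ← PowerSeries.coeff_zero_eq_constantCoeff_apply]
  simp [expSubOneDivX]

/-- `(t / (e^t - 1)) ^ l` as a power series over `ℚ`, for an arbitrary integer `l`. -/
noncomputable def bernoulliFactor (l : ℤ) : PowerSeries ℚ :=
  ((isUnit_expSubOneDivX.unit ^ (-l) : (PowerSeries ℚ)ˣ) : PowerSeries ℚ)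

/-- The higher order Bernoulli polynomial `B_n^{(l)}(x)`, defined by
`(t / (e^t - 1)) ^ l * e^{tx} = ∑ B_n^{(l)}(x) tⁿ / n!` in `ℚ[x]⟦t⟧`. -/
noncomputable def higherBernoulli (n : ℕ) (l : ℤ) : Polynomial ℚ :=
  Polynomial.C (Nat.factorial n : ℚ) *
    PowerSeries.coeff n
      (PowerSeries.map Polynomial.C (bernoulliFactor l) *
        PowerSeries.rescale (Polynomial.X : Polynomial ℚ)
          (PowerSeries.exp (Polynomial ℚ)))

/-- The maximum pole of a rational polynomial: the exponent of the highest power of `p` that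
occurs in the denominator of one of its coefficients. -/
def maxPole (p : ℕ) (f : Polynomial ℚ) : ℕ :=
  f.support.sup fun i => padicValNat p (f.coeff i).den

/-- The almost minimum zero (AMZ) estimate for `ν_p (S(n, k))`, where `1 ≤ k ≤ n`:
`ν_p (n choose k)` minus the maximum pole of `B_{n-k}^{(-k)}(x)`. -/
noncomputable def amzEstimate (p n k : ℕ) : ℤ :=
  (padicValNat p (n.choose k) : ℤ) - (maxPole p (higherBernoulli (n - k) (-(k : ℤ))) : ℤ)

/-- The shifted almost minimum zero (SAMZ) estimate for `ν_p (S(n, k))`, where `1 ≤ k ≤ n`: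
`ν_p (n - 1 choose k - 1)` minus the maximum pole of `B_{n-k}^{(-k+1)}(x)`. -/
noncomputable def samzEstimate (p n k : ℕ) : ℤ :=
  (padicValNat p ((n - 1).choose (k - 1)) : ℤ) -
    (maxPole p (higherBernoulli (n - k) (-(k : ℤ) + 1)) : ℤ)

/-- `S(n, k)` is an almost minimum zero case: the AMZ estimate is sharp. -/
def IsAMZC (p n k : ℕ) : Prop :=
  1 ≤ k ∧ k ≤ n ∧ (padicValNat p (Nat.stirlingSecond n k) : ℤ) = amzEstimate p n k

/-- `S(n, k)` is a shifted almost minimum zero case: the SAMZ estimate is sharp. -/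
def IsSAMZC (p n k : ℕ) : Prop :=
  1 ≤ k ∧ k ≤ n ∧ (padicValNat p (Nat.stirlingSecond n k) : ℤ) = samzEstimate p n k

/-! Write `k = 2 ^ h` and `n + 1 = c * 2 ^ h + u`. The coefficients of `B_{n-j}^{(-j)}` are `C(n,r)
S(r,j) / C(n,j)`, so the AMZ estimate is the least valuation of a term `C(n,r) S(r,j)`; the SAMZ
estimate for `(n+1, k)` is the AMZ estimate for `(n, k-1)`.

Since `(n+1) C(n,r) S(r,k-1) = C(n+1,r+1) (r+1) S(r,k-1)`, everything rests on `ν₂((r+1) S(r,k-1))`.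
Expanding `t = log(1 + (eᵗ - 1))` gives `Nat.succ_mul_stirlingSecond`, an alternating sum for `(r+1)
S(r,k-1)`. For `h ≥ 2`, modulo `2 ^ h` only two of its terms survive, leaving `2 ^ (h-1) *
(S(r+1,k+1) + S(r+1,k+3))` (`Nat.two_pow_dvd_mul_stirlingSecond_sub`). Hence the valuation is at
least `h - 1`, with equality iff the bracket is odd. Generating series over `ZMod 2` turn that
parity into the listed conditions on `u`.

The bound is attained at `r + 1 = c * 2 ^ h + 2 ^ ν₂(u)`, which evaluates the estimate. Finally
`S(n+1,k) ≡ S(n,k-1)` modulo `2 ^ h` carries the result to `S(n+1,k)`. -/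

/-! ### Odd binomial coefficients -/

/-- One step of Lucas' theorem at the prime `2`, in terms of parity. -/
theorem Nat.odd_choose_iff (n k : ℕ) :
    Odd (n.choose k) ↔ Odd ((n % 2).choose (k % 2)) ∧ Odd ((n / 2).choose (k / 2)) := by
  have := Choose.choose_modEq_choose_mod_mul_choose_div_nat (p := 2) (n := n) (k := k)
  rw [← Nat.odd_mul, Nat.odd_iff, Nat.odd_iff, this]

theorem Nat.odd_choose_mul_two_pow (c h u : ℕ) (hu : u < 2 ^ h) :
    Odd ((c * 2 ^ h + u).choose (c * 2 ^ h)) := by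
  induction h generalizing u with
  | zero => simp [show u = 0 by simpa using hu]
  | succ h ih =>
    rw [Nat.odd_choose_iff]
    have e1 : c * 2 ^ (h + 1) = 2 * (c * 2 ^ h) := by ring
    rw [pow_succ] at hu
    rw [e1, show (2 * (c * 2 ^ h) + u) / 2 = c * 2 ^ h + u / 2 by omega,
      show (2 * (c * 2 ^ h)) / 2 = c * 2 ^ h by omega,
      show (2 * (c * 2 ^ h)) % 2 = 0 by omega]
    exact ⟨by simp, ih _ (by omega)⟩

/-- Keeping only the lowest binary digit of `u` leaves a subset of the digits of the upper entry, so
Lucas applies. This supplies the term at which the AMZ minimum is attained. -/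
theorem Nat.odd_choose_lowest_bit (c h u : ℕ) (hu0 : 0 < u) (hu : u < 2 ^ h) :
    Odd ((c * 2 ^ h + u).choose (c * 2 ^ h + 2 ^ padicValNat 2 u)) := by
  induction h generalizing u with
  | zero => simp at hu; omega
  | succ h ih =>
    rw [Nat.odd_choose_iff]
    have e1 : c * 2 ^ (h + 1) = 2 * (c * 2 ^ h) := by ring
    rw [pow_succ] at hu
    rcases Nat.even_or_odd' u with ⟨v, rfl | rfl⟩
    · have hv : v ≠ 0 := by omega
      rw [padicValNat.mul (by norm_num) hv, padicValNat_self, e1, pow_add, pow_one,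
        ← mul_add, ← mul_add]
      simp only [Nat.mul_mod_right, Nat.choose_self, odd_one, true_and]
      rw [Nat.mul_div_cancel_left _ (by norm_num), Nat.mul_div_cancel_left _ (by norm_num)]
      exact ih v (by omega) (by omega)
    · rw [padicValNat.eq_zero_of_not_dvd (by omega), pow_zero, e1,
        show (2 * (c * 2 ^ h) + (2 * v + 1)) / 2 = c * 2 ^ h + v by omega,
        show (2 * (c * 2 ^ h) + 1) / 2 = c * 2 ^ h by omega,
        show (2 * (c * 2 ^ h) + (2 * v + 1)) % 2 = 1 by omega,
        show (2 * (c * 2 ^ h) + 1) % 2 = 1 by omega]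
      exact ⟨by simp, Nat.odd_choose_mul_two_pow c h v (by omega)⟩

/-! ### The logarithm identity and its reduction modulo a power of two -/

/-- Truncated form of the coefficient identity behind
`t * (eᵗ - 1) ^ j = ∑ (-1) ^ i * (eᵗ - 1) ^ (j + i + 1) / (i + 1)`, one recursion step. -/
theorem Nat.sum_stirlingSecond_succ_succ (M w j : ℕ) :
    ∑ i ∈ Finset.range M, (-1 : ℤ) ^ i * i.factorial * (j + 1 + i + 1).choose (i + 1) *
        Nat.stirlingSecond (w + 1) (j + 1 + i + 1) =
      (j + 1) * ∑ i ∈ Finset.range M, (-1 : ℤ) ^ i * i.factorial *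
          (j + 1 + i + 1).choose (i + 1) * Nat.stirlingSecond w (j + 1 + i + 1) +
        ∑ i ∈ Finset.range M, (-1 : ℤ) ^ i * i.factorial * (j + i + 1).choose (i + 1) *
          Nat.stirlingSecond w (j + i + 1) +
        Nat.stirlingSecond w (j + 1) -
        (-1 : ℤ) ^ M * M.factorial * (j + M + 1).choose M * Nat.stirlingSecond w (j + M + 1) := by
  induction M with
  | zero => simp
  | succ M ih =>
    rw [Finset.sum_range_succ, Finset.sum_range_succ, Finset.sum_range_succ, ih,
      Nat.stirlingSecond_succ_succ, Nat.factorial_succ]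
    have h1 : (j + 1 + M + 1).choose (M + 1) = (j + M + 1).choose M + (j + M + 1).choose (M + 1) := by
      rw [show j + 1 + M = j + M + 1 by ring]; rfl
    rw [show j + (M + 1) + 1 = j + 1 + M + 1 by ring, h1, show j + 1 + M = j + M + 1 by ring]
    push_cast
    ring

/-- Coefficient comparison in `t * (eᵗ - 1) ^ j`. Terms with `i > w` vanish, so every cutoff `M > w`
gives the full sum. The Stirling recurrence drives the induction; for `j = 0` the sum telescopes. -/
theorem Nat.succ_mul_stirlingSecond (M w j : ℕ) (hM : w < M) :
    ((w : ℤ) + 1) * Nat.stirlingSecond w j =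
      ∑ i ∈ Finset.range M, (-1 : ℤ) ^ i * i.factorial * (j + i + 1).choose (i + 1) *
        Nat.stirlingSecond (w + 1) (j + i + 1) := by
  induction w generalizing j with
  | zero =>
    obtain ⟨M, rfl⟩ : ∃ N, M = N + 1 := ⟨M - 1, by omega⟩
    rw [Finset.sum_range_succ', Finset.sum_eq_zero]
    · cases j <;> simp [Nat.stirlingSecond]
    · intro i _
      rw [Nat.stirlingSecond_eq_zero_of_lt (by omega : 0 + 1 < j + (i + 1) + 1)]
      simp
  | succ w ih =>
    cases j with
    | zero =>
      have key : ∀ N : ℕ, ∑ i ∈ Finset.range N, (-1 : ℤ) ^ i * i.factorial *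
          (0 + i + 1).choose (i + 1) * Nat.stirlingSecond (w + 1 + 1) (0 + i + 1) =
          -((-1) ^ N * N.factorial * Nat.stirlingSecond (w + 1) N) := by
        intro N
        induction N with
        | zero => simp
        | succ N ihN =>
          rw [Finset.sum_range_succ, ihN, zero_add, Nat.stirlingSecond_succ_succ (w + 1) N,
            Nat.factorial_succ, Nat.choose_self]
          push_cast
          ring
      rw [key, Nat.stirlingSecond_eq_zero_of_lt hM]
      simp
    | succ j =>
      have h := Nat.sum_stirlingSecond_succ_succ M (w + 1) j
      rw [Nat.stirlingSecond_eq_zero_of_lt (by omega : w + 1 < j + M + 1), ← ih _ (by omega),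
        ← ih _ (by omega)] at h
      rw [h, Nat.stirlingSecond_succ_succ]
      push_cast
      ring

/-- By absorption, `(i + 1) * C(2 ^ h + i, i + 1)` is a multiple of `2 ^ h`. An odd `i + 1` cancels,
and an even `i + 1 > 4` divides `i!`; the exceptions are `2 ∤ 1!` and `4 ∤ 3!`. -/
theorem Nat.two_pow_dvd_factorial_mul_choose (h i : ℕ) (h1 : i ≠ 1) (h3 : i ≠ 3) :
    2 ^ h ∣ i.factorial * (2 ^ h + i).choose (i + 1) := by
  have key : (2 ^ h + i).choose (i + 1) * (i + 1) = (2 ^ h + i).choose i * 2 ^ h := by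
    have := Nat.choose_succ_right_eq (2 ^ h + i) i
    rwa [Nat.add_sub_cancel] at this
  have hdvd : 2 ^ h ∣ (i + 1) * (i.factorial * (2 ^ h + i).choose (i + 1)) := by
    rw [show (i + 1) * (i.factorial * (2 ^ h + i).choose (i + 1)) =
      i.factorial * ((2 ^ h + i).choose (i + 1) * (i + 1)) by ring, key]
    exact ⟨i.factorial * (2 ^ h + i).choose i, by ring⟩
  rcases Nat.even_or_odd' (i + 1) with ⟨m, hm | hm⟩
  · obtain ⟨q, hq⟩ : i + 1 ∣ i.factorial := by
      have hm3 : 2 < m := by omega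
      refine Dvd.dvd.trans ?_ (Nat.factorial_dvd_factorial (by omega : m ≤ i))
      rw [hm, ← Nat.mul_factorial_pred (by omega : m ≠ 0), mul_comm]
      exact Nat.mul_dvd_mul_left _ (Nat.dvd_factorial (by norm_num) (by omega))
    rw [hq, show (i + 1) * q * (2 ^ h + i).choose (i + 1) =
      q * ((2 ^ h + i).choose (i + 1) * (i + 1)) by ring, key]
    exact ⟨q * (2 ^ h + i).choose i, by ring⟩
  · refine Nat.Coprime.dvd_of_dvd_mul_left ?_ hdvd
    apply Nat.Coprime.pow_left
    rw [Nat.coprime_two_left, Nat.odd_iff]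
    omega

/-- In the logarithm identity only `i = 1` and `i = 3` survive. Both coefficients are odd multiples
of `2 ^ (h + 1)`, and modulo `2 ^ (h + 2)` neither the odd factor nor the sign matters. -/
theorem Nat.two_pow_dvd_mul_stirlingSecond_sub (h w : ℕ) :
    (2 : ℤ) ^ (h + 2) ∣ (w + 1) * Nat.stirlingSecond w (2 ^ (h + 2) - 1) -
      2 ^ (h + 1) * (Nat.stirlingSecond (w + 1) (2 ^ (h + 2) + 1) +
        Nat.stirlingSecond (w + 1) (2 ^ (h + 2) + 3)) := by
  obtain ⟨j, hj⟩ : ∃ j, 2 ^ (h + 2) = j + 1 := ⟨2 ^ (h + 2) - 1, by have := Nat.two_pow_pos (h + 2); omega⟩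
  have hjz : (j : ℤ) = 4 * 2 ^ h - 1 := by
    have : ((2 ^ (h + 2) : ℕ) : ℤ) = ((j + 1 : ℕ) : ℤ) := by rw [hj]
    push_cast at this
    rw [pow_add] at this
    linarith
  have hdvd : ∀ i, i ≠ 1 → i ≠ 3 → ∀ s : ℤ,
      (2 : ℤ) ^ (h + 2) ∣ (-1) ^ i * i.factorial * (j + i + 1).choose (i + 1) * s := by
    intro i h1 h3 s
    have := Nat.two_pow_dvd_factorial_mul_choose (h + 2) i h1 h3
    rw [show 2 ^ (h + 2) + i = j + i + 1 by omega] at this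
    rw [mul_assoc ((-1 : ℤ) ^ i)]
    refine Dvd.dvd.mul_right (Dvd.dvd.mul_left ?_ _) _
    exact_mod_cast this
  have c2 : ((j + 1 + 1).choose 2 : ℤ) = 2 ^ (h + 1) + 2 ^ (h + 2) * 2 ^ (h + 1) := by
    have : ((j + 1 + 1).choose 2 * 2 : ℤ) = (j + 2) * (j + 1) := by
      have := Nat.descFactorial_eq_factorial_mul_choose (j + 2) 2
      simp [Nat.descFactorial, Nat.factorial] at this
      zify at this
      linarith
    rw [hjz] at this
    have e1 : (2 : ℤ) ^ (h + 1) = 2 * 2 ^ h := by ring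
    have e2 : (2 : ℤ) ^ (h + 2) = 4 * 2 ^ h := by ring
    rw [e1, e2]
    linarith
  have c4 : (6 * (j + 3 + 1).choose 4 : ℤ) =
      2 ^ (h + 1) * ((2 ^ (h + 1) + 1) * (2 ^ (h + 2) + 1) * (2 ^ (h + 2) + 3)) := by
    have : (24 * (j + 3 + 1).choose 4 : ℤ) = (j + 4) * (j + 3) * (j + 2) * (j + 1) := by
      have := Nat.descFactorial_eq_factorial_mul_choose (j + 4) 4
      simp [Nat.descFactorial, Nat.factorial] at this
      zify at this
      linarith
    rw [hjz] at this
    have e1 : (2 : ℤ) ^ (h + 1) = 2 * 2 ^ h := by ring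
    have e2 : (2 : ℤ) ^ (h + 2) = 4 * 2 ^ h := by ring
    rw [e1, e2]
    linarith
  -- The cutoff is chosen so that the terms `i = 0, 1, 2, 3` can always be split off.
  rw [hj, Nat.add_sub_cancel, Nat.succ_mul_stirlingSecond (w + 1 + 4) w j (by omega),
    Finset.sum_range_succ', Finset.sum_range_succ', Finset.sum_range_succ',
    Finset.sum_range_succ']
  have hrest := Finset.dvd_sum (s := Finset.range (w + 1)) (fun i _ =>
    hdvd (i + 1 + 1 + 1 + 1) (by omega) (by omega)
      (Nat.stirlingSecond (w + 1) (j + (i + 1 + 1 + 1 + 1) + 1)))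
  have h0 := hdvd 0 (by omega) (by omega) (Nat.stirlingSecond (w + 1) (j + 0 + 1))
  have h2 := hdvd (0 + 1 + 1) (by omega) (by omega) (Nat.stirlingSecond (w + 1) (j + (0 + 1 + 1) + 1))
  generalize (∑ i ∈ Finset.range (w + 1), _ : ℤ) = A at hrest ⊢
  generalize ((-1 : ℤ) ^ 0 * _ * _ * _) = B at h0 ⊢
  generalize ((-1 : ℤ) ^ (0 + 1 + 1) * _ * _ * _) = C at h2 ⊢
  obtain ⟨A, rfl⟩ := hrest
  obtain ⟨B, rfl⟩ := h0
  obtain ⟨C, rfl⟩ := h2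
  simp only [zero_add, Nat.reduceAdd, Nat.factorial, pow_one]
  rw [show j + 1 + 3 = j + 3 + 1 by ring]
  generalize (Nat.stirlingSecond (w + 1) (j + 1 + 1) : ℤ) = s1
  generalize (Nat.stirlingSecond (w + 1) (j + 3 + 1) : ℤ) = s3
  rw [c2]
  refine ⟨A + B + C - s1 * (1 + 2 * 2 ^ h) -
    s3 * (2 + 11 * 2 ^ h + 24 * (2 ^ h) ^ 2 + 16 * (2 ^ h) ^ 3), ?_⟩
  push_cast
  have e1 : (2 : ℤ) ^ (h + 1) = 2 * 2 ^ h := by ring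
  have e2 : (2 : ℤ) ^ (h + 2) = 4 * 2 ^ h := by ring
  rw [e1, e2] at c4 ⊢
  linear_combination (-s3) * c4

/-! ### Parity of Stirling numbers by generating series -/

/-- The generating series of `n ↦ S(n, k)` modulo `2`. -/
noncomputable def stirlingSeriesModTwo (k : ℕ) : PowerSeries (ZMod 2) :=
  PowerSeries.mk fun n => (Nat.stirlingSecond n k : ZMod 2)

theorem stirlingSeriesModTwo_zero : stirlingSeriesModTwo 0 = 1 := by
  ext n
  cases n <;> simp [stirlingSeriesModTwo, PowerSeries.coeff_one]

theorem stirlingSeriesModTwo_succ (k : ℕ) :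
    stirlingSeriesModTwo (k + 1) = PowerSeries.X *
      (((k + 1 : ℕ) : PowerSeries (ZMod 2)) * stirlingSeriesModTwo (k + 1) +
        stirlingSeriesModTwo k) := by
  ext n
  cases n with
  | zero => simp [stirlingSeriesModTwo]
  | succ n =>
    rw [PowerSeries.coeff_succ_X_mul, map_add, ← map_natCast (PowerSeries.C (R := ZMod 2)),
      PowerSeries.coeff_C_mul]
    simp [stirlingSeriesModTwo, Nat.stirlingSecond_succ_succ]

theorem PowerSeries.two_eq_zero_zmod_two : (2 : PowerSeries (ZMod 2)) = 0 := by
  rw [← map_ofNat (PowerSeries.C (R := ZMod 2)) 2, show (OfNat.ofNat 2 : ZMod 2) = 0 from rfl,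
    map_zero]

/-- Modulo `2`, passing to an odd index multiplies the series by `X / (1 + X)`, and passing to an
even one multiplies it by `X`. -/
theorem stirlingSeriesModTwo_even (m : ℕ) :
    stirlingSeriesModTwo (2 * m) * (1 + PowerSeries.X) ^ m = PowerSeries.X ^ (2 * m) ∧
    stirlingSeriesModTwo (2 * m + 1) * (1 + PowerSeries.X) ^ (m + 1) =
      PowerSeries.X ^ (2 * m + 1) := by
  have h2 := PowerSeries.two_eq_zero_zmod_two
  have hodd : ∀ m : ℕ, stirlingSeriesModTwo (2 * m + 1) * (1 + PowerSeries.X) =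
      PowerSeries.X * stirlingSeriesModTwo (2 * m) := by
    intro m
    have := stirlingSeriesModTwo_succ (2 * m)
    push_cast at this
    linear_combination this + h2 * (m + 1 : PowerSeries (ZMod 2)) * PowerSeries.X *
      stirlingSeriesModTwo (2 * m + 1)
  have heven : ∀ m : ℕ, stirlingSeriesModTwo (2 * m + 2) =
      PowerSeries.X * stirlingSeriesModTwo (2 * m + 1) := by
    intro m
    have := stirlingSeriesModTwo_succ (2 * m + 1)
    push_cast at this
    linear_combination this + h2 * (m + 1 : PowerSeries (ZMod 2)) * PowerSeries.X *
      stirlingSeriesModTwo (2 * m + 2)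
  have main : stirlingSeriesModTwo (2 * m) * (1 + PowerSeries.X) ^ m = PowerSeries.X ^ (2 * m) := by
    induction m with
    | zero => simp [stirlingSeriesModTwo_zero]
    | succ m ih =>
      rw [show 2 * (m + 1) = 2 * m + 2 by ring, heven]
      linear_combination PowerSeries.X * (1 + PowerSeries.X) ^ m * hodd m +
        PowerSeries.X ^ 2 * ih
  exact ⟨main, by linear_combination (1 + PowerSeries.X) ^ m * hodd m + PowerSeries.X * main⟩

/-- Frobenius turns `(1 + X) ^ 2 ^ s` into `1 + X ^ 2 ^ s`, which makes the coefficients of the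
quotient explicit. -/
theorem stirlingSeriesModTwo_add (s : ℕ) :
    (stirlingSeriesModTwo (2 ^ (s + 1) + 1) + stirlingSeriesModTwo (2 ^ (s + 1) + 3)) *
      ((1 + PowerSeries.X ^ 2 ^ s) * (1 + PowerSeries.X ^ 2)) =
    PowerSeries.X ^ (2 ^ (s + 1) + 1) * (1 + PowerSeries.X + PowerSeries.X ^ 2) := by
  have h2 := PowerSeries.two_eq_zero_zmod_two
  have h1 := (stirlingSeriesModTwo_even (2 ^ s)).2
  have h3 := (stirlingSeriesModTwo_even (2 ^ s + 1)).2
  have : CharP (PowerSeries (ZMod 2)) 2 := CharTwo.of_one_ne_zero_of_two_eq_zero one_ne_zero h2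
  have hq : (1 + PowerSeries.X : PowerSeries (ZMod 2)) ^ 2 ^ s = 1 + PowerSeries.X ^ 2 ^ s := by
    rw [add_pow_char_pow, one_pow]
  have hsq : (1 + PowerSeries.X : PowerSeries (ZMod 2)) ^ 2 = 1 + PowerSeries.X ^ 2 := by
    rw [add_pow_char, one_pow]
  rw [← hq, ← hsq, show 2 ^ (s + 1) = 2 * 2 ^ s by ring]
  rw [show 2 * (2 ^ s + 1) + 1 = 2 * 2 ^ s + 3 by ring] at h3
  linear_combination (1 + PowerSeries.X) * h1 + h3

/-- The indicator series of the exponents `m` for which the coefficient of `X ^ m` in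
`(1 + X + X ^ 2) / ((1 + X ^ q) * (1 + X ^ 2))` is odd, `q` even. -/
noncomputable def oddCoeffSeries (q : ℕ) : PowerSeries (ZMod 2) :=
  PowerSeries.mk fun m => if Odd m ∧ Even (m / q) ∨ Even m ∧ q ∣ m then 1 else 0

theorem oddCoeffSeries_mul (q : ℕ) (hq : 0 < q) (hqe : Even q) :
    oddCoeffSeries q * ((1 + PowerSeries.X ^ q) * (1 + PowerSeries.X ^ 2)) =
      1 + PowerSeries.X + PowerSeries.X ^ 2 := by
  -- A shift by `q` flips the parity of `m / q` and, `q` being even, preserves that of `m`: odd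
  -- exponents get exactly one contribution, positive even ones cancel.
  have h1 : oddCoeffSeries q * (1 + PowerSeries.X ^ q) =
      PowerSeries.mk fun m => if m = 0 ∨ Odd m then (1 : ZMod 2) else 0 := by
    ext m
    rw [mul_add, mul_one, map_add, PowerSeries.coeff_mul_X_pow']
    simp only [oddCoeffSeries, PowerSeries.coeff_mk]
    by_cases hqm : q ≤ m
    · rw [if_pos hqm]
      obtain ⟨d, rfl⟩ := Nat.exists_eq_add_of_le hqm
      rw [Nat.add_sub_cancel_left]
      have hdiv : (q + d) / q = d / q + 1 := by rw [Nat.add_div_left _ hq]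
      have hodd : Odd (q + d) ↔ Odd d := by
        rw [Nat.odd_add']; simp [hqe]
      have heven : Even (q + d) ↔ Even d := by
        rw [Nat.even_add]; simp [hqe]
      have hdvd : q ∣ q + d ↔ q ∣ d := Nat.dvd_add_right dvd_rfl
      have hpar : Even (d / q + 1) ↔ ¬ Even (d / q) := by rw [Nat.even_add_one]
      have hne : q + d ≠ 0 := by omega
      simp only [hdiv, hodd, heven, hdvd, hpar]
      rcases Nat.even_or_odd d with hd | hd
      · have hd' : ¬ Odd d := by simpa using hd
        rw [if_neg (not_or.2 ⟨hne, hd'⟩)]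
        by_cases hqd : q ∣ d <;> simp [hd, hd', hqd]
        rfl
      · have hd' : ¬ Even d := by simpa using hd
        by_cases hqd : Even (d / q) <;> simp [hd, hd', hqd]
    · have hlt : m < q := by omega
      rw [if_neg hqm, Nat.div_eq_of_lt hlt]
      have : q ∣ m ↔ m = 0 :=
        ⟨fun hd => Nat.eq_zero_of_dvd_of_lt hd hlt, fun h => h ▸ dvd_zero q⟩
      rw [add_zero]
      refine if_congr ?_ rfl rfl
      rw [this]
      constructor
      · rintro (⟨h, -⟩ | ⟨-, h⟩)
        · exact Or.inr h
        · exact Or.inl h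
      · rintro (rfl | h)
        · simp
        · exact Or.inl ⟨h, by simp⟩
  rw [← mul_assoc, h1]
  ext m
  rw [mul_add, mul_one, map_add, PowerSeries.coeff_mul_X_pow']
  simp only [PowerSeries.coeff_mk, map_add, PowerSeries.coeff_X_pow, PowerSeries.coeff_X,
    PowerSeries.coeff_one]
  match m with
  | 0 => simp
  | 1 => simp
  | 2 => simp
  | m + 3 =>
    rw [show m + 3 - 2 = m + 1 by omega]
    rcases Nat.even_or_odd m with hm | hm
    · have a : Odd (m + 3) := hm.add_odd (by decide)
      have b : Odd (m + 1) := hm.add_one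
      simp [a, b]; rfl
    · have a : ¬ Odd (m + 3) := Nat.not_odd_iff_even.2 (hm.add_odd (by decide))
      have b : ¬ Odd (m + 1) := Nat.not_odd_iff_even.2 hm.add_one
      simp [a, b]

theorem Nat.odd_stirlingSecond_add_iff (s m : ℕ) (hs : s ≠ 0) :
    Odd (Nat.stirlingSecond (2 ^ (s + 1) + 1 + m) (2 ^ (s + 1) + 1) +
      Nat.stirlingSecond (2 ^ (s + 1) + 1 + m) (2 ^ (s + 1) + 3)) ↔
    Odd m ∧ Even (m / 2 ^ s) ∨ Even m ∧ 2 ^ s ∣ m := by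
  have hB := oddCoeffSeries_mul (2 ^ s) (by positivity) (Nat.even_pow.2 ⟨even_two, hs⟩)
  have hne : ((1 + PowerSeries.X ^ 2 ^ s) * (1 + PowerSeries.X ^ 2) : PowerSeries (ZMod 2)) ≠ 0 := by
    intro h0
    have := congrArg PowerSeries.constantCoeff h0
    simp at this
  have hG : stirlingSeriesModTwo (2 ^ (s + 1) + 1) + stirlingSeriesModTwo (2 ^ (s + 1) + 3) =
      PowerSeries.X ^ (2 ^ (s + 1) + 1) * oddCoeffSeries (2 ^ s) := by
    apply mul_right_cancel₀ hne
    rw [stirlingSeriesModTwo_add, mul_assoc, hB]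
  have hc := congrArg (PowerSeries.coeff (m + (2 ^ (s + 1) + 1))) hG
  rw [PowerSeries.coeff_X_pow_mul, map_add] at hc
  simp only [stirlingSeriesModTwo, oddCoeffSeries, PowerSeries.coeff_mk] at hc
  rw [← ZMod.natCast_eq_one_iff_odd, add_comm (2 ^ (s + 1) + 1) m]
  push_cast
  rw [hc]
  split_ifs with hm <;> simp [hm]

theorem Nat.odd_stirlingSecond_add_iff' (h c u : ℕ) (hc : 0 < c) (hu : 0 < u)
    (huh : u < 2 ^ (h + 2)) :
    Odd (Nat.stirlingSecond (c * 2 ^ (h + 2) + u) (2 ^ (h + 2) + 1) +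
      Nat.stirlingSecond (c * 2 ^ (h + 2) + u) (2 ^ (h + 2) + 3)) ↔
    (Even u ∧ u ≤ 2 ^ (h + 1)) ∨ u = 1 ∨ u = 1 + 2 ^ (h + 1) := by
  obtain ⟨c, rfl⟩ : ∃ d, c = d + 1 := ⟨c - 1, by omega⟩
  obtain ⟨v, rfl⟩ : ∃ d, u = d + 1 := ⟨u - 1, by omega⟩
  have hq : 0 < 2 ^ (h + 1) := by positivity
  have e : 2 ^ (h + 2) = 2 ^ (h + 1) * 2 := by ring
  -- The multiple of `2 ^ (h + 1)` is even, so `c` affects neither the parity of the quotient nor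
  -- divisibility.
  have hn : (c + 1) * 2 ^ (h + 2) + (v + 1) = 2 ^ (h + 2) + 1 + (2 ^ (h + 1) * (2 * c) + v) := by
    rw [e]; ring
  rw [hn, Nat.odd_stirlingSecond_add_iff (h + 1) _ (by omega), Nat.mul_add_div hq,
    Nat.dvd_add_right (Dvd.intro _ rfl)]
  have p1 : Odd (2 ^ (h + 1) * (2 * c) + v) ↔ Even (v + 1) := by
    simp [Nat.odd_add', Nat.even_add_one, parity_simps]
  have p2 : Even (2 ^ (h + 1) * (2 * c) + v) ↔ ¬ Even (v + 1) := by
    simp [Nat.even_add_one, parity_simps]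
  have p3 : Even (2 * c + v / 2 ^ (h + 1)) ↔ v + 1 ≤ 2 ^ (h + 1) := by
    have hlt : v / 2 ^ (h + 1) < 2 := by rw [Nat.div_lt_iff_lt_mul hq]; omega
    have h0 : v / 2 ^ (h + 1) = 0 ↔ v < 2 ^ (h + 1) := by
      rw [Nat.div_eq_zero_iff]; omega
    generalize v / 2 ^ (h + 1) = x at hlt h0
    rw [Nat.even_iff]
    omega
  have p4 : 2 ^ (h + 1) ∣ v ↔ v = 0 ∨ v = 2 ^ (h + 1) := by
    constructor
    · rintro ⟨d, rfl⟩
      have : d < 2 := by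
        by_contra hd
        have := Nat.mul_le_mul_left (2 ^ (h + 1)) (not_lt.1 hd)
        omega
      interval_cases d <;> simp
    · rintro (rfl | rfl) <;> simp
  rw [p1, p2, p3, p4]
  have p5 : Even (2 ^ (h + 1)) := Nat.even_pow.2 ⟨even_two, by omega⟩
  constructor
  · rintro (h | ⟨-, h | h⟩)
    · exact Or.inl h
    · exact Or.inr (Or.inl (by omega))
    · exact Or.inr (Or.inr (by omega))
  · rintro (h | h | h)
    · exact Or.inl h
    · exact Or.inr ⟨by rw [h]; simp, Or.inl (by omega)⟩
    · refine Or.inr ⟨?_, Or.inr (by omega)⟩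
      rw [h, Nat.even_add]
      simp [p5]

/-! ### Coefficients of the higher order Bernoulli polynomials -/

-- Differentiating `(eᵗ - 1) ^ (j + 1)` reproduces the Stirling recurrence.
open PowerSeries in
theorem PowerSeries.coeff_exp_sub_one_pow (n j : ℕ) :
    (n.factorial : ℚ) * coeff n ((exp ℚ - 1) ^ j) = j.factorial * Nat.stirlingSecond n j := by
  induction n generalizing j with
  | zero =>
    cases j <;> simp
  | succ n ih =>
    cases j with
    | zero => simp [coeff_one]
    | succ j =>
      have hD : d⁄dX ℚ ((exp ℚ - 1) ^ (j + 1)) =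
          ((j + 1 : ℕ) : ℚ) • ((exp ℚ - 1) ^ (j + 1) + (exp ℚ - 1) ^ j) := by
        rw [derivative_pow, map_sub, derivative_exp, derivative_one, sub_zero, Nat.add_sub_cancel,
          PowerSeries.smul_eq_C_mul, map_natCast]
        ring
      have hc := congrArg (coeff n) hD
      rw [coeff_derivative, map_smul, map_add, smul_eq_mul] at hc
      have h1 := ih (j + 1)
      have h2 := ih j
      rw [Nat.stirlingSecond_succ_succ, Nat.factorial_succ]
      rw [Nat.factorial_succ] at h1
      rw [Nat.factorial_succ]
      push_cast at *
      linear_combination (n.factorial : ℚ) * hc + (j + 1) * h1 + (j + 1) * h2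

theorem coeff_bernoulliFactor_neg (m j : ℕ) :
    ((m + j).factorial : ℚ) * PowerSeries.coeff m (bernoulliFactor (-j)) =
      j.factorial * Nat.stirlingSecond (m + j) j := by
  have hb : bernoulliFactor (-j) = expSubOneDivX ^ j := by
    simp [bernoulliFactor]
  rw [hb, ← PowerSeries.coeff_exp_sub_one_pow, ← X_mul_expSubOneDivX, mul_pow,
    PowerSeries.coeff_X_pow_mul]

/-- With `n = N + j` and `r = n - i`, the factorials combine into `C(n,r) S(r,j) / C(n,j)`. The
denominator does not depend on `i`, so the maximum pole is governed by the smallest numerator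
valuation. -/
theorem coeff_higherBernoulli_neg (N j i : ℕ) :
    (higherBernoulli N (-j)).coeff i =
      if i ≤ N then ((N + j).choose (N - i + j) * Nat.stirlingSecond (N - i + j) j : ℕ) /
        ((N + j).choose j : ℚ) else 0 := by
  have hcoe : (higherBernoulli N (-j)).coeff i = N.factorial *
      if i ≤ N then PowerSeries.coeff (N - i) (bernoulliFactor (-j)) * (1 / (i.factorial : ℚ))
        else 0 := by
    rw [higherBernoulli, Polynomial.coeff_C_mul, PowerSeries.coeff_mul, Polynomial.finsetSum_coeff]
    congr 1
    have hterm : ∀ x : ℕ × ℕ, (PowerSeries.coeff x.1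
          (PowerSeries.map Polynomial.C (bernoulliFactor (-j))) *
        PowerSeries.coeff x.2 (PowerSeries.rescale (Polynomial.X : Polynomial ℚ)
          (PowerSeries.exp (Polynomial ℚ)))).coeff i =
        if x.2 = i then PowerSeries.coeff x.1 (bernoulliFactor (-j)) * (1 / (i.factorial : ℚ))
          else 0 := by
      intro x
      rw [PowerSeries.coeff_map, PowerSeries.coeff_rescale, PowerSeries.coeff_exp,
        Polynomial.coeff_C_mul, Polynomial.algebraMap_eq, Polynomial.coeff_mul_C,
        Polynomial.coeff_X_pow]
      by_cases h : x.2 = i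
      · simp [h]
      · simp [h, Ne.symm h]
    rw [Finset.sum_congr rfl fun x _ => hterm x]
    split_ifs with hi
    · rw [Finset.sum_eq_single (N - i, i)]
      · simp
      · rintro ⟨a, b⟩ hab hne
        rw [if_neg]
        rintro rfl
        rw [Finset.HasAntidiagonal.mem_antidiagonal] at hab
        exact hne (by simp; omega)
      · intro h
        exact absurd (Finset.HasAntidiagonal.mem_antidiagonal.2 (Nat.sub_add_cancel hi)) h
    · refine Finset.sum_eq_zero fun x hx => if_neg ?_
      rw [Finset.HasAntidiagonal.mem_antidiagonal] at hx
      omega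
  rw [hcoe]
  split_ifs with hi
  · have hb := coeff_bernoulliFactor_neg (N - i) j
    have hf := fun k : ℕ => (Nat.cast_ne_zero (R := ℚ)).2 k.factorial_ne_zero
    rw [eq_div_of_mul_eq (hf _) ((mul_comm _ _).trans hb)]
    push_cast
    rw [Nat.cast_choose ℚ (by omega : N - i + j ≤ N + j), Nat.cast_choose ℚ (by omega : j ≤ N + j),
      Nat.add_sub_cancel, show N + j - (N - i + j) = i by omega]
    have := hf N; have := hf i; have := hf j; have := hf (N + j); have := hf (N - i + j)
    field_simp
  · simp

theorem Nat.stirlingSecond_pos (n k : ℕ) (hk : 0 < k) (hkn : k ≤ n) :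
    0 < Nat.stirlingSecond n k := by
  induction n, hkn using Nat.le_induction with
  | base => rw [Nat.stirlingSecond_self]; exact one_pos
  | succ n hn ih =>
    rw [Nat.stirlingSecond_succ_left _ _ hk.ne']
    positivity

/-! ### The AMZ estimate as a minimum -/

theorem padicValNat_den_div (p a b : ℕ) [hp : Fact p.Prime] (ha : a ≠ 0) (hb : b ≠ 0) :
    padicValNat p ((a : ℚ) / b).den = padicValNat p b - padicValNat p a := by
  have ha' : (a : ℚ) ≠ 0 := by exact_mod_cast ha
  have hb' : (b : ℚ) ≠ 0 := by exact_mod_cast hb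
  set q := (a : ℚ) / b with hq
  have hv : padicValRat p q = padicValNat p a - padicValNat p b := by
    rw [hq, padicValRat.div ha' hb', padicValRat.of_nat, padicValRat.of_nat]
  rw [padicValRat_def, padicValInt] at hv
  have hcop : padicValNat p q.num.natAbs = 0 ∨ padicValNat p q.den = 0 := by
    by_contra! h
    have h1 := dvd_of_one_le_padicValNat (Nat.one_le_iff_ne_zero.2 h.1)
    have h2 := dvd_of_one_le_padicValNat (Nat.one_le_iff_ne_zero.2 h.2)
    exact hp.out.not_dvd_one (q.reduced ▸ Nat.dvd_gcd h1 h2)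
  omega

/-- The AMZ estimate is the least `p`-adic valuation of a term of the sum
`∑ r, (n choose r) * S(r, k)`. -/
theorem amzEstimate_eq_of_isLeast (p n k : ℕ) [Fact p.Prime] (a : ℕ) (hk : 0 < k) (hkn : k ≤ n)
    (hle : ∀ r, k ≤ r → r ≤ n → a ≤ padicValNat p (n.choose r * Nat.stirlingSecond r k))
    (hex : ∃ r, k ≤ r ∧ r ≤ n ∧ padicValNat p (n.choose r * Nat.stirlingSecond r k) = a) :
    amzEstimate p n k = a := by
  obtain ⟨N, rfl⟩ : ∃ N, n = N + k := ⟨n - k, by omega⟩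
  have hP : (N + k).choose k ≠ 0 := (Nat.choose_pos hkn).ne'
  have hT : ∀ i ≤ N, (N + k).choose (N - i + k) * Nat.stirlingSecond (N - i + k) k ≠ 0 := by
    intro i hi
    exact mul_ne_zero (Nat.choose_pos (by omega)).ne' (Nat.stirlingSecond_pos _ _ hk (by omega)).ne'
  have hden : ∀ i ≤ N, padicValNat p ((higherBernoulli N (-k)).coeff i).den =
      padicValNat p ((N + k).choose k) -
        padicValNat p ((N + k).choose (N - i + k) * Nat.stirlingSecond (N - i + k) k) := by
    intro i hi
    rw [coeff_higherBernoulli_neg, if_pos hi, padicValNat_den_div _ _ _ (hT i hi) hP]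
  have hsup : maxPole p (higherBernoulli N (-k)) = padicValNat p ((N + k).choose k) - a := by
    apply le_antisymm
    · refine Finset.sup_le fun i hi => ?_
      have hiN : i ≤ N := by
        by_contra h
        rw [Polynomial.mem_support_iff, coeff_higherBernoulli_neg, if_neg h] at hi
        exact hi rfl
      rw [hden i hiN]
      have := hle (N - i + k) (by omega) (by omega)
      omega
    · obtain ⟨r, hkr, hrn, hr⟩ := hex
      have hi : N - (N + k - r) + k = r := by omega
      have h1 := hden (N + k - r) (by omega)
      rw [hi, hr] at h1
      rw [← h1]
      refine Finset.le_sup (f := fun i => padicValNat p ((higherBernoulli N (-k)).coeff i).den) ?_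
      rw [Polynomial.mem_support_iff, coeff_higherBernoulli_neg, if_pos (by omega)]
      have := hT (N + k - r) (by omega)
      positivity
  -- The term `r = k` gives `a ≤ ν_p(C(n,k))`, so the truncated subtraction in `hsup` is exact.
  have hPa := hle k le_rfl hkn
  rw [Nat.stirlingSecond_self, mul_one] at hPa
  rw [amzEstimate, Nat.add_sub_cancel, hsup]
  omega

theorem samzEstimate_eq_amzEstimate (p n k : ℕ) :
    samzEstimate p (n + 1) (k + 1) = amzEstimate p n k := by
  rw [samzEstimate, amzEstimate, Nat.add_sub_cancel, Nat.add_sub_cancel, Nat.add_sub_add_right]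
  congr 4
  push_cast
  ring

/-! ### Valuations at `2 ^ h - 1` and the theorem -/

theorem le_padicValNat_mul_stirlingSecond (h w : ℕ) (hw : 2 ^ (h + 1) ≤ w + 1) :
    h ≤ padicValNat 2 ((w + 1) * Nat.stirlingSecond w (2 ^ (h + 1) - 1)) := by
  cases h with
  | zero => exact Nat.zero_le _
  | succ h =>
    have h2 : 2 ≤ 2 ^ (h + 1 + 1) := Nat.le_self_pow (by omega) 2
    have hpos := Nat.stirlingSecond_pos w (2 ^ (h + 1 + 1) - 1) (by omega) (by omega)
    rw [← padicValNat_dvd_iff_le (by positivity)]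
    have h1 := (pow_dvd_pow 2 (by omega : h + 1 ≤ h + 2)).trans
      (Nat.two_pow_dvd_mul_stirlingSecond_sub h w)
    rw [dvd_sub_left (Dvd.intro _ rfl)] at h1
    exact_mod_cast h1

theorem padicValNat_mul_stirlingSecond_eq_iff (h c u w : ℕ) (hc : 0 < c) (hu : 0 < u)
    (huh : u < 2 ^ (h + 1)) (hw : c * 2 ^ (h + 1) + u = w + 1) :
    padicValNat 2 ((w + 1) * Nat.stirlingSecond w (2 ^ (h + 1) - 1)) = h ↔
      (Even u ∧ u ≤ 2 ^ h) ∨ u = 1 ∨ u = 1 + 2 ^ h := by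
  have hkw : 2 ^ (h + 1) ≤ w := by
    have := Nat.mul_le_mul_right (2 ^ (h + 1)) (Nat.one_le_iff_ne_zero.2 hc.ne')
    omega
  cases h with
  | zero =>
    -- The congruence needs exponent at least `2`; here the product is the odd number `2 * c + 1`.
    have hu1 : u = 1 := by omega
    obtain ⟨v, rfl⟩ : ∃ v, w = v + 1 := ⟨w - 1, by omega⟩
    rw [show 2 ^ (0 + 1) - 1 = 1 from rfl, Nat.stirlingSecond_one_right,
      padicValNat.eq_zero_of_not_dvd (by omega)]
    simp [hu1]
  | succ h =>
    have h2 : 2 ≤ 2 ^ (h + 1 + 1) := Nat.le_self_pow (by omega) 2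
    have hpos := Nat.stirlingSecond_pos w (2 ^ (h + 1 + 1) - 1) (by omega) (by omega)
    have hle := le_padicValNat_mul_stirlingSecond (h + 1) w (by omega)
    rw [← Nat.odd_stirlingSecond_add_iff' h c u hc hu huh, hw]
    have key : 2 ^ (h + 2) ∣ (w + 1) * Nat.stirlingSecond w (2 ^ (h + 1 + 1) - 1) ↔
        2 ∣ Nat.stirlingSecond (w + 1) (2 ^ (h + 2) + 1) +
          Nat.stirlingSecond (w + 1) (2 ^ (h + 2) + 3) := by
      have h1 := Nat.two_pow_dvd_mul_stirlingSecond_sub h w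
      have h3 := dvd_iff_dvd_of_dvd_sub h1
      rw [pow_succ (2 : ℤ) (h + 1), mul_dvd_mul_iff_left (by positivity)] at h3
      rw [pow_succ 2 (h + 1)]
      exact_mod_cast h3
    rw [padicValNat_dvd_iff_le (by positivity)] at key
    rw [← Nat.not_even_iff_odd, even_iff_two_dvd, ← key]
    omega

theorem padicValNat_two_pow_mul_add (c h u : ℕ) (hu : 0 < u) (huh : u < 2 ^ h) :
    padicValNat 2 (c * 2 ^ h + u) = padicValNat 2 u ∧ padicValNat 2 u < h := by
  have hlt : padicValNat 2 u < h := by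
    by_contra hge
    have := Nat.le_of_dvd hu ((padicValNat_dvd_iff_le hu.ne').2 (not_lt.1 hge))
    omega
  refine ⟨?_, hlt⟩
  have key : ∀ t ≤ h, t ≤ padicValNat 2 (c * 2 ^ h + u) ↔ t ≤ padicValNat 2 u := by
    intro t ht
    rw [← padicValNat_dvd_iff_le (by omega), ← padicValNat_dvd_iff_le hu.ne']
    exact Nat.dvd_add_right (Dvd.dvd.mul_left (pow_dvd_pow 2 ht) c)
  have h1 := key _ hlt.le
  have h2 := key (padicValNat 2 u + 1) hlt
  omega

/-- Absorption trades the fixed factor `n + 1` for `r + 1`, which makes one lower bound serve every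
term. -/
theorem padicValNat_choose_mul_stirlingSecond (n r k : ℕ) (hr : r ≤ n) (hk : 0 < k) (hkr : k ≤ r) :
    padicValNat 2 (n + 1) + padicValNat 2 (n.choose r * Nat.stirlingSecond r k) =
      padicValNat 2 ((n + 1).choose (r + 1)) +
        padicValNat 2 ((r + 1) * Nat.stirlingSecond r k) := by
  have hS := (Nat.stirlingSecond_pos r k hk hkr).ne'
  have hC := (Nat.choose_pos hr).ne'
  have hC' := (Nat.choose_pos (Nat.succ_le_succ hr)).ne'
  rw [← padicValNat.mul (by omega) (mul_ne_zero hC hS),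
    ← padicValNat.mul hC' (mul_ne_zero (by omega) hS), ← mul_assoc, Nat.add_one_mul_choose_eq,
    mul_assoc]

theorem amzEstimate_two_pow_sub_one (h c u n : ℕ) (hc : 0 < c) (hu : 0 < u)
    (huh : u < 2 ^ (h + 1)) (hn : c * 2 ^ (h + 1) + u = n + 1) :
    amzEstimate 2 n (2 ^ (h + 1) - 1) = (h - padicValNat 2 u : ℕ) := by
  have h2 : 2 ≤ 2 ^ (h + 1) := Nat.le_self_pow (by omega) 2
  have hcle := Nat.mul_le_mul_right (2 ^ (h + 1)) (Nat.one_le_iff_ne_zero.2 hc.ne')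
  obtain ⟨hv, hvh⟩ := padicValNat_two_pow_mul_add c (h + 1) u hu huh
  rw [hn] at hv
  refine amzEstimate_eq_of_isLeast 2 n _ _ (by omega) (by omega) ?_ ?_
  · intro r hkr hrn
    have h1 := padicValNat_choose_mul_stirlingSecond n r (2 ^ (h + 1) - 1) hrn (by omega) hkr
    have h3 := le_padicValNat_mul_stirlingSecond h r (by omega)
    omega
  · have hdvd : 2 ^ padicValNat 2 u ∣ u := pow_padicValNat_dvd
    have hle := Nat.le_of_dvd hu hdvd
    have hpos : 0 < 2 ^ padicValNat 2 u := by positivity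
    obtain ⟨r, hr⟩ : ∃ r, c * 2 ^ (h + 1) + 2 ^ padicValNat 2 u = r + 1 :=
      ⟨c * 2 ^ (h + 1) + 2 ^ padicValNat 2 u - 1, by omega⟩
    refine ⟨r, by omega, by omega, ?_⟩
    have h1 := padicValNat_choose_mul_stirlingSecond n r (2 ^ (h + 1) - 1) (by omega) (by omega)
      (by omega)
    have h3 : padicValNat 2 ((n + 1).choose (r + 1)) = 0 := by
      rw [← hn, ← hr]
      apply padicValNat.eq_zero_of_not_dvd
      rw [← even_iff_two_dvd, Nat.not_even_iff_odd]
      exact Nat.odd_choose_lowest_bit c (h + 1) u hu huh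
    -- The lowest bit of `u` is `1` or an even number at most `2 ^ h`, hence always a case of
    -- equality.
    have h4 := (padicValNat_mul_stirlingSecond_eq_iff h c _ r hc hpos (by omega) hr).2 (by
      rcases Nat.eq_zero_or_pos (padicValNat 2 u) with h0 | h0
      · right; left; rw [h0, pow_zero]
      · left
        exact ⟨Nat.even_pow.2 ⟨even_two, h0.ne'⟩, Nat.pow_le_pow_right (by norm_num) (by omega)⟩)
    omega

theorem mainTheorem11 (h u c : ℕ) (hc : 0 < c) (hu : 0 < u) (huh : u < 2 ^ h) :
    (samzEstimate 2 (c * 2 ^ h + u) (2 ^ h) = (h : ℤ) - 1 - (padicValNat 2 u : ℤ) ∧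
      (h : ℤ) - 1 - (padicValNat 2 u : ℤ) ≤
        (padicValNat 2 (Nat.stirlingSecond (c * 2 ^ h + u) (2 ^ h)) : ℤ)) ∧
    (IsSAMZC 2 (c * 2 ^ h + u) (2 ^ h) ↔
      (Even u ∧ u ≤ 2 ^ (h - 1)) ∨ u = 1 ∨ u = 1 + 2 ^ (h - 1)) ∧
    ((Even u ∧ u ≤ 2 ^ (h - 1)) ∨ u = 1 ∨ u = 1 + 2 ^ (h - 1) →
      IsAMZC 2 (c * 2 ^ h + u - 1) (2 ^ h - 1) ∧
      (padicValNat 2 (Nat.stirlingSecond (c * 2 ^ h + u) (2 ^ h)) : ℤ) =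
        (padicValNat 2 (Nat.stirlingSecond (c * 2 ^ h + u - 1) (2 ^ h - 1)) : ℤ) ∧
      (padicValNat 2 (Nat.stirlingSecond (c * 2 ^ h + u - 1) (2 ^ h - 1)) : ℤ) =
        (h : ℤ) - 1 - (padicValNat 2 u : ℤ)) := by
  obtain ⟨h, rfl⟩ : ∃ g, h = g + 1 := ⟨h - 1, by cases h <;> simp_all⟩
  have h2 : 2 ≤ 2 ^ (h + 1) := Nat.le_self_pow (by omega) 2
  have hcle := Nat.mul_le_mul_right (2 ^ (h + 1)) (Nat.one_le_iff_ne_zero.2 hc.ne')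
  obtain ⟨hv, hvh⟩ := padicValNat_two_pow_mul_add c (h + 1) u hu huh
  obtain ⟨n, hn⟩ : ∃ n, c * 2 ^ (h + 1) + u = n + 1 := ⟨c * 2 ^ (h + 1) + u - 1, by omega⟩
  have hamz := amzEstimate_two_pow_sub_one h c u n hc hu huh hn
  have hsamz : samzEstimate 2 (n + 1) (2 ^ (h + 1)) = (h - padicValNat 2 u : ℕ) := by
    rw [← hamz, ← samzEstimate_eq_amzEstimate, Nat.sub_add_cancel (by omega)]
  have hle := le_padicValNat_mul_stirlingSecond h n (by omega)
  have hiff := padicValNat_mul_stirlingSecond_eq_iff h c u n hc hu huh hn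
  have hpos := Nat.stirlingSecond_pos n (2 ^ (h + 1) - 1) (by omega) (by omega)
  have hpos' := Nat.stirlingSecond_pos (n + 1) (2 ^ (h + 1)) (by omega) (by omega)
  rw [padicValNat.mul (by omega) hpos.ne'] at hle hiff
  -- The recurrence makes the two Stirling numbers congruent modulo `2 ^ (h + 1)`. Testing at the
  -- estimate and one above it then settles both bound and equality.
  have hcomp : ∀ t ≤ h + 1, t ≤ padicValNat 2 (Nat.stirlingSecond (n + 1) (2 ^ (h + 1))) ↔
      t ≤ padicValNat 2 (Nat.stirlingSecond n (2 ^ (h + 1) - 1)) := by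
    intro t ht
    rw [← padicValNat_dvd_iff_le hpos'.ne', ← padicValNat_dvd_iff_le hpos.ne',
      Nat.stirlingSecond_succ_left _ _ (by omega)]
    exact Nat.dvd_add_right (Dvd.dvd.mul_right (pow_dvd_pow 2 ht) _)
  have hc1 := hcomp (h - padicValNat 2 u) (by omega)
  have hc2 := hcomp (h - padicValNat 2 u + 1) (by omega)
  rw [hn] at hv
  rw [IsSAMZC, IsAMZC, hn, Nat.add_sub_cancel, Nat.add_sub_cancel, hsamz, hamz, ← hiff]
  refine ⟨⟨?_, ?_⟩, ⟨?_, ?_⟩, fun hgood => ⟨⟨?_, ?_, ?_⟩, ?_, ?_⟩⟩ <;> omega
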